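/- Throughout, C$^*$-algebras are complex, unital C$^*$-algebras are nonzero (i.e. $1\neq 0$), C$^*$-morphisms between unital C$^*$-algebras are unit-preserving $*$-homomorphisms, and $\{x,y\}:=xy+yx$. Let $(V,(\cdot\,,\cdot))$ be a complex pre-Hilbert space (not necessarily complete), where $(\cdot\,,\cdot)$ is positive definite, linear in the first and anti-linear in the second argument, and let $J:V\to V$ be multiplication by $i$. For a unital C$^*$-algebra $A$ and an anti-linear map $\mathbf a:V\to A$ consider the conditions (i) $A$ is generated by $\mathbf a(V)$ as a unital C$^*$-algebra; (ii) $\{\mathbf a(v_1),\mathbf a(v_2)\}=0$ for all $v_1,v_2\in V$; (iii) $\{\mathbf a(v_1)^*,\mathbf a(v_2)\}=(v_1,v_2)\cdot 1$ for all $v_1,v_2\in V$. The pair $(\mathbf a,A)$ is called a CAR-representation of $V$ if (i), (ii) and (iii) hold. Let $V_{\mathbb C}=V\otimes_{\mathbb R}\mathbb C$ be the complexification of the real vector space underlying $V$, and let $q_{\mathbb C}$ be the complex-bilinear extension of $\mathrm{Re}(\cdot\,,\cdot)$ to $V_{\mathbb C}$. Let $\mathrm{Cl}_{\mathrm{alg}}(V_{\mathbb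 C},q_{\mathbb C})$ be the complex Clifford algebra with relations $x\cdot y+y\cdot x=-2q_{\mathbb C}(x,y)1$ for $x,y\in V_{\mathbb C}$, with the anti-linear anti-multiplicative involution $*$ that is given by $x^*=-\bar x$ for $x\in V_{\mathbb C}$. The C$^*$-Clifford algebra $\mathrm{Cl}(V_{\mathbb C},q_{\mathbb C})$ is the (Hausdorff) completion of $\mathrm{Cl}_{\mathrm{alg}}(V_{\mathbb C},q_{\mathbb C})$ with respect to $\|a\|_\infty=\sup_\pi\|\pi(a)\|$, where $\pi$ runs over all $*$-homomorphisms from $\mathrm{Cl}_{\mathrm{alg}}(V_{\mathbb C},q_{\mathbb C})$ to C$^*$-algebras. **Theorem.** (1) Let $\mathbf a:V\to \mathrm{Cl}(V_{\mathbb C},q_{\mathbb C})$ be given by $\mathbf a(v)=\frac12(v+iJv)$, where $v$ and $Jv$ are regarded as elements of $V_{\mathbb C}$. Then $(\mathbf a,\mathrm{Cl}(V_{\mathbb C},q_{\mathbb C}))$ is a CAR-representation of $V$; in particular $\mathrm{Cl}(V_{\mathbb C},q_{\mathbb C})\neq 0$. (2) Let $\widehat A$ be any unital C$^*$-algebra and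 let $\widehat{\mathbf a}:V\to\widehat A$ be any anti-linear map satisfying (ii) and (iii). Then there is a unique C$^*$-morphism $\widetilde\alpha:\mathrm{Cl}(V_{\mathbb C},q_{\mathbb C})\to\widehat A$ with $\widetilde\alpha\circ\mathbf a=\widehat{\mathbf a}$. Moreover, $\widetilde\alpha$ is injective. (3) A CAR-representation of $V$ exists, and it is unique up to C$^*$-isomorphism: if $(\mathbf a_1,A_1)$ and $(\mathbf a_2,A_2)$ are CAR-representations of $V$, then there is an isomorphism of unital C$^*$-algebras $\Phi:A_1\to A_2$ with $\Phi\circ\mathbf a_1=\mathbf a_2$. -/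

import Mathlib

open scoped TensorProduct ComplexConjugate

universe u w w₁ w₂

set_option linter.unusedSectionVars false

noncomputable section

/-! ### C⋆-seminorms and C⋆-completions of complex ⋆-algebras -/

/-- A C⋆-seminorm on a unital complex ⋆-algebra. -/
structure CStarSeminorm (A : Type u) [Ring A] [StarRing A] [Algebra ℂ A] extends
    RingSeminorm A where
  smul' : ∀ (z : ℂ) (a : A), toFun (z • a) = ‖z‖ * toFun a
  star_mul_self' : ∀ a : A, toFun (star a * a) = toFun a * toFun a

namespace CStarSeminorm

variable {A : Type u} [Ring A] [StarRing A] [Algebra ℂ A] [StarModule ℂ A]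

theorem star_le (p : CStarSeminorm A) (a : A) :
    p.toRingSeminorm a ≤ p.toRingSeminorm (star a) := by
  have h1 : p.toRingSeminorm (star a * a) = p.toRingSeminorm a * p.toRingSeminorm a :=
    p.star_mul_self' a
  have h2 := map_mul_le_mul p.toRingSeminorm (star a) a
  rcases (apply_nonneg p.toRingSeminorm a).eq_or_lt with h | h
  · rw [← h]; exact apply_nonneg _ _
  · rw [h1] at h2; exact le_of_mul_le_mul_right h2 h

theorem map_star (p : CStarSeminorm A) (a : A) :
    p.toRingSeminorm (star a) = p.toRingSeminorm a :=
  le_antisymm (by simpa using p.star_le (star a)) (p.star_le a)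

/-- The ⋆-algebra `A`, carrying the topology of the seminorm `p`. -/
def Dom (_p : CStarSeminorm A) : Type u := A

variable (p : CStarSeminorm A)

instance : SeminormedRing p.Dom := p.toRingSeminorm.toSeminormedRing

instance : NormedAlgebra ℂ p.Dom where
  __ := (inferInstanceAs (Algebra ℂ A) : Algebra ℂ A)
  norm_smul_le z a := (p.smul' z a).le

instance : StarRing p.Dom := inferInstanceAs (StarRing A)

instance : StarModule ℂ p.Dom := inferInstanceAs (StarModule ℂ A)

theorem norm_star_dom (a : p.Dom) : ‖star a‖ = ‖a‖ := p.map_star a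

theorem norm_star_mul_self_dom (a : p.Dom) : ‖star a * a‖ = ‖a‖ * ‖a‖ := p.star_mul_self' a

theorem uniformContinuous_star_dom : UniformContinuous (star : p.Dom → p.Dom) :=
  (AddMonoidHomClass.isometry_of_norm (starAddEquiv : p.Dom ≃+ p.Dom)
    p.norm_star_dom).uniformContinuous

/-- The (Hausdorff) completion of a ⋆-algebra with respect to a C⋆-seminorm. -/
def Completed : Type u := UniformSpace.Completion p.Dom

instance : NormedRing p.Completed := inferInstanceAs (NormedRing (UniformSpace.Completion p.Dom))

instance : CompleteSpace p.Completed :=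
  inferInstanceAs (CompleteSpace (UniformSpace.Completion p.Dom))

instance : Algebra ℂ p.Completed := inferInstanceAs (Algebra ℂ (UniformSpace.Completion p.Dom))

instance : NormedAlgebra ℂ p.Completed where
  norm_smul_le := norm_smul_le (α := ℂ) (β := UniformSpace.Completion p.Dom)

/-- The canonical map of a ⋆-algebra to its completion. -/
def ofDom (a : A) : p.Completed := ((show p.Dom from a : p.Dom) : UniformSpace.Completion p.Dom)

theorem denseRange_ofDom : DenseRange p.ofDom :=
  UniformSpace.Completion.denseRange_coe (α := p.Dom)

theorem norm_ofDom (a : A) : ‖p.ofDom a‖ = p.toRingSeminorm a :=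
  UniformSpace.Completion.norm_coe (E := p.Dom) a

theorem ofDom_add (a b : A) : p.ofDom (a + b) = p.ofDom a + p.ofDom b :=
  UniformSpace.Completion.coe_add (α := p.Dom) a b

theorem ofDom_mul (a b : A) : p.ofDom (a * b) = p.ofDom a * p.ofDom b :=
  UniformSpace.Completion.coe_mul (α := p.Dom) a b

theorem ofDom_one : p.ofDom 1 = 1 := UniformSpace.Completion.coe_one p.Dom

theorem ofDom_smul (z : ℂ) (a : A) : p.ofDom (z • a) = z • p.ofDom a :=
  UniformSpace.Completion.coe_smul (X := p.Dom) z a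

/-- The star operation on the completion is the continuous extension of the given one. -/
instance : Star p.Completed := ⟨UniformSpace.Completion.map (star : p.Dom → p.Dom)⟩

theorem continuous_star_completed : Continuous (star : p.Completed → p.Completed) :=
  UniformSpace.Completion.continuous_map (f := (star : p.Dom → p.Dom))

theorem ofDom_star (a : A) : p.ofDom (star a) = star (p.ofDom a) :=
  (UniformSpace.Completion.map_coe p.uniformContinuous_star_dom a).symm

@[elab_as_elim]
theorem induction_completed {P : p.Completed → Prop} (x : p.Completed)
    (hc : IsClosed {x | P x}) (h : ∀ a : A, P (p.ofDom a)) : P x :=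
  isClosed_property p.denseRange_ofDom hc h x

instance : StarRing p.Completed where
  star_involutive x := by
    have := p.continuous_star_completed
    refine induction_completed p x (isClosed_eq (by fun_prop) (by fun_prop)) fun a => ?_
    rw [← ofDom_star, ← ofDom_star, star_star]
  star_mul x y := by
    have := p.continuous_star_completed
    refine induction_completed p x (isClosed_eq (by fun_prop) (by fun_prop)) fun a => ?_
    refine induction_completed p y (isClosed_eq (by fun_prop) (by fun_prop)) fun b => ?_
    rw [← ofDom_mul, ← ofDom_star, star_mul, ofDom_mul, ofDom_star, ofDom_star]
  star_add x y := by
    have := p.continuous_star_completed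
    refine induction_completed p x (isClosed_eq (by fun_prop) (by fun_prop)) fun a => ?_
    refine induction_completed p y (isClosed_eq (by fun_prop) (by fun_prop)) fun b => ?_
    rw [← ofDom_add, ← ofDom_star, star_add, ofDom_add, ofDom_star, ofDom_star]

instance : StarModule ℂ p.Completed where
  star_smul z x := by
    have hs := p.continuous_star_completed
    refine induction_completed p x (isClosed_eq (hs.comp (continuous_const_smul z))
      (hs.const_smul (star z))) fun a => ?_
    rw [← ofDom_smul, ← ofDom_star, star_smul, ofDom_smul, ofDom_star]

instance : CStarRing p.Completed where
  norm_mul_self_le x := by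
    have := p.continuous_star_completed
    refine induction_completed p x (isClosed_le (by fun_prop) (by fun_prop)) fun a => ?_
    rw [← ofDom_star, ← ofDom_mul, norm_ofDom, norm_ofDom]
    exact (p.star_mul_self' a).ge

/-- The completion of a ⋆-algebra with respect to a C⋆-seminorm is a unital C⋆-algebra. -/
instance : CStarAlgebra p.Completed where

end CStarSeminorm

/-! ### The maximal C⋆-seminorm -/

section MaxSeminorm

variable {A : Type u} [Ring A] [StarRing A] [Algebra ℂ A] [StarModule ℂ A]

/-- The set of all numbers `‖π a‖`, where `π` is a ⋆-homomorphism from `A` to a C⋆-algebra.  Every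
⋆-homomorphism from `A` to a C⋆-algebra corestricts to one with dense range, whose target is
isomorphic to a completion of a quotient of `A`; hence C⋆-algebras in the universe of `A`
suffice. -/
def repNorms (a : A) : Set ℝ :=
  {r | ∃ (B : Type u) (_ : NonUnitalCStarAlgebra B) (π : A →⋆ₙₐ[ℂ] B), r = ‖π a‖}

/-- `‖a‖_∞ = sup ‖π a‖` over all ⋆-homomorphisms `π` from `A` to C⋆-algebras. -/
def maxCStarNorm (a : A) : ℝ := sSup (repNorms a)

theorem repNorms_nonempty (a : A) : (repNorms a).Nonempty :=
  ⟨_, PUnit.{u + 1} → ℂ, inferInstance, 0, rfl⟩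

theorem maxCStarNorm_le {a : A} {c : ℝ}
    (h : ∀ (B : Type u) (_ : NonUnitalCStarAlgebra B) (π : A →⋆ₙₐ[ℂ] B), ‖π a‖ ≤ c) :
    maxCStarNorm a ≤ c :=
  csSup_le (repNorms_nonempty a) (by rintro _ ⟨B, i, π, rfl⟩; exact h B i π)

theorem le_maxCStarNorm {a : A} (hb : BddAbove (repNorms a)) {B : Type u}
    [i : NonUnitalCStarAlgebra B] (π : A →⋆ₙₐ[ℂ] B) : ‖π a‖ ≤ maxCStarNorm a :=
  le_csSup hb ⟨B, i, π, rfl⟩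

theorem maxCStarNorm_nonneg {a : A} (hb : BddAbove (repNorms a)) : 0 ≤ maxCStarNorm a := by
  obtain ⟨_, B, i, π, rfl⟩ := repNorms_nonempty a
  exact (norm_nonneg _).trans (le_maxCStarNorm hb π)

/-- If all the suprema are finite, then `‖·‖_∞` is a C⋆-seminorm. -/
def maxCStarSeminorm (hb : ∀ a : A, BddAbove (repNorms a)) : CStarSeminorm A where
  toFun := maxCStarNorm
  map_zero' := le_antisymm (maxCStarNorm_le fun B _ π => by simp) (maxCStarNorm_nonneg (hb 0))
  add_le' a b := maxCStarNorm_le fun B _ π => by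
    rw [map_add]
    exact (norm_add_le _ _).trans (add_le_add (le_maxCStarNorm (hb a) π) (le_maxCStarNorm (hb b) π))
  neg' a := by
    refine le_antisymm (maxCStarNorm_le fun B _ π => ?_) (maxCStarNorm_le fun B _ π => ?_)
    · rw [map_neg, norm_neg]; exact le_maxCStarNorm (hb a) π
    · rw [← norm_neg, ← map_neg]; exact le_maxCStarNorm (hb (-a)) π
  mul_le' a b := maxCStarNorm_le fun B _ π => by
    rw [map_mul]
    exact (norm_mul_le _ _).trans (mul_le_mul (le_maxCStarNorm (hb a) π)
      (le_maxCStarNorm (hb b) π) (norm_nonneg _) (maxCStarNorm_nonneg (hb a)))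
  smul' z a := by
    have key : ∀ (z : ℂ) (a : A), maxCStarNorm (z • a) ≤ ‖z‖ * maxCStarNorm a := fun z a =>
      maxCStarNorm_le fun B _ π => by
        rw [map_smul, norm_smul]
        exact mul_le_mul_of_nonneg_left (le_maxCStarNorm (hb a) π) (norm_nonneg z)
    refine le_antisymm (key z a) ?_
    by_cases hz : z = 0
    · subst hz; simpa using maxCStarNorm_nonneg (hb _)
    · have h := key z⁻¹ (z • a)
      rw [smul_smul, inv_mul_cancel₀ hz, one_smul, norm_inv] at h
      have hz' : 0 < ‖z‖ := norm_pos_iff.mpr hz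
      rwa [inv_mul_eq_div, le_div_iff₀' hz'] at h
  star_mul_self' a := by
    have h0 := maxCStarNorm_nonneg (hb a)
    refine le_antisymm (maxCStarNorm_le fun B _ π => ?_) ?_
    · rw [map_mul, StarHomClass.map_star, CStarRing.norm_star_mul_self]
      exact mul_self_le_mul_self (norm_nonneg _) (le_maxCStarNorm (hb a) π)
    · have h1 : maxCStarNorm a ≤ Real.sqrt (maxCStarNorm (star a * a)) :=
        maxCStarNorm_le fun B _ π => by
          refine Real.le_sqrt_of_sq_le ?_
          rw [sq, ← CStarRing.norm_star_mul_self, ← StarHomClass.map_star, ← map_mul]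
          exact le_maxCStarNorm (hb _) π
      calc maxCStarNorm a * maxCStarNorm a
          ≤ Real.sqrt (maxCStarNorm (star a * a)) * Real.sqrt (maxCStarNorm (star a * a)) :=
            mul_self_le_mul_self h0 h1
        _ = _ := Real.mul_self_sqrt (maxCStarNorm_nonneg (hb _))

end MaxSeminorm

/-! ### The Clifford algebra of the complexification of a complex pre-Hilbert space -/

section Clifford

variable (V : Type u) [NormedAddCommGroup V] [InnerProductSpace ℂ V]

/-- The real bilinear form `Re (v, w)` on `V`. -/
def reInnerForm : LinearMap.BilinForm ℝ V :=
  LinearMap.mk₂ ℝ (fun v w => (inner ℂ v w).re)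
    (fun a b c => by simp)
    (fun r a b => by simp [← Complex.coe_smul, mul_comm])
    (fun a b c => by simp)
    (fun r a b => by simp [← Complex.coe_smul])

/-- The complex bilinear extension `q_ℂ` of `Re (v, w)` to `V_ℂ = ℂ ⊗[ℝ] V`. -/
def qC : LinearMap.BilinForm ℂ (ℂ ⊗[ℝ] V) :=
  LinearMap.BilinForm.baseChange ℂ (reInnerForm V)

/-- The real quadratic form `v ↦ -(v, v)` on `V`. -/
def negNormSq : QuadraticForm ℝ V := -(LinearMap.BilinMap.toQuadraticMap (reInnerForm V))

/-- The algebraic Clifford algebra of `(V_ℂ, q_ℂ)` with the sign convention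
`x * y + y * x = -2 q_ℂ(x, y)` (see `CliffordC.ι_mul_ι_add_swap`). -/
def CliffordC : Type u := CliffordAlgebra (QuadraticForm.baseChange ℂ (negNormSq V))

namespace CliffordC

instance : Ring (CliffordC V) :=
  inferInstanceAs (Ring (CliffordAlgebra (QuadraticForm.baseChange ℂ (negNormSq V))))

instance : Algebra ℂ (CliffordC V) :=
  inferInstanceAs (Algebra ℂ (CliffordAlgebra (QuadraticForm.baseChange ℂ (negNormSq V))))

/-- The canonical map `V_ℂ → Cl_alg(V_ℂ, q_ℂ)`. -/
def ι : (ℂ ⊗[ℝ] V) →ₗ[ℂ] CliffordC V :=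
  CliffordAlgebra.ι (QuadraticForm.baseChange ℂ (negNormSq V))

theorem ι_mul_ι_add_swap (x y : ℂ ⊗[ℝ] V) :
    ι V x * ι V y + ι V y * ι V x = algebraMap ℂ (CliffordC V) (-2 * qC V x y) := by
  have h := CliffordAlgebra.ι_mul_ι_add_swap (Q := QuadraticForm.baseChange ℂ (negNormSq V)) x y
  refine h.trans ?_
  congr 1
  have hp : ∀ v w : V, QuadraticMap.polarBilin (negNormSq V) v w = -2 * reInnerForm V v w := by
    intro v w
    have hs : (inner ℂ w v).re = (inner ℂ v w).re := by
      rw [← inner_conj_symm, Complex.conj_re]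
    simp only [QuadraticMap.polarBilin_apply_apply, negNormSq, QuadraticMap.polar,
      neg_apply, LinearMap.BilinMap.toQuadraticMap_apply, reInnerForm,
      LinearMap.mk₂_apply, inner_add_left, inner_add_right, Complex.add_re, hs]
    ring
  clear h
  rw [← QuadraticMap.polarBilin_apply_apply, QuadraticForm.polarBilin_baseChange, qC]
  induction x with
  | zero => simp
  | add x₁ x₂ h₁ h₂ => simp only [map_add, LinearMap.add_apply, h₁, h₂, mul_add]
  | tmul a v =>
    induction y with
    | zero => simp
    | add y₁ y₂ h₁ h₂ => simp only [map_add, h₁, h₂, mul_add]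
    | tmul b w =>
      rw [LinearMap.BilinForm.baseChange_tmul, LinearMap.BilinForm.baseChange_tmul, hp]
      simp only [Complex.real_smul]
      push_cast
      ring

end CliffordC

instance : StarModule ℝ (CliffordAlgebra (negNormSq V)) :=
  ⟨fun r x => by simp [CliffordAlgebra.star_smul]⟩

/-- `Cl_alg(V_ℂ, q_ℂ)` as the complexification of the real Clifford algebra of `V`. -/
def CliffordC.equivTensor : CliffordC V ≃ₐ[ℂ] ℂ ⊗[ℝ] CliffordAlgebra (negNormSq V) :=
  CliffordAlgebra.equivBaseChange ℂ (negNormSq V)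

namespace CliffordC

theorem equivTensor_ι (z : ℂ) (v : V) :
    equivTensor V (ι V (z ⊗ₜ v)) = z ⊗ₜ CliffordAlgebra.ι (negNormSq V) v :=
  CliffordAlgebra.toBaseChange_ι ℂ (negNormSq V) z v

/-- The star operation on `Cl_alg(V_ℂ, q_ℂ)`: the antilinear antimultiplicative map that extends
`z ⊗ v ↦ -(conj z ⊗ v)` on `V_ℂ` (see `CliffordC.star_ι`). -/
instance : StarRing (CliffordC V) where
  star x := (equivTensor V).symm (star (equivTensor V x))
  star_involutive x := by simp
  star_mul x y := by simp
  star_add x y := by simp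

theorem star_def (x : CliffordC V) :
    star x = (equivTensor V).symm (star (equivTensor V x)) := rfl

theorem star_ι (z : ℂ) (v : V) : star (ι V (z ⊗ₜ v)) = -ι V (conj z ⊗ₜ v) := by
  rw [star_def, equivTensor_ι, TensorProduct.star_tmul, CliffordAlgebra.star_ι,
    TensorProduct.tmul_neg, map_neg, ← equivTensor_ι, AlgEquiv.symm_apply_apply]
  rfl

instance : StarModule ℂ (CliffordC V) where
  star_smul z x := by
    have key : ∀ t : ℂ ⊗[ℝ] CliffordAlgebra (negNormSq V), star (z • t) = star z • star t := by
      intro t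
      induction t with
      | zero => rw [smul_zero, star_zero, smul_zero]
      | tmul a b =>
        rw [TensorProduct.smul_tmul', TensorProduct.star_tmul, TensorProduct.star_tmul,
          TensorProduct.smul_tmul', smul_eq_mul, smul_eq_mul, star_mul']
      | add a b ha hb => rw [smul_add, star_add, star_add, smul_add, ha, hb]
    rw [star_def, star_def, map_smul, key, map_smul]

end CliffordC

theorem CliffordC.bddAbove_repNorms (a : CliffordC V) : BddAbove (repNorms a) := by
  suffices h : ∃ c : ℝ, ∀ (B : Type u) (_ : NonUnitalCStarAlgebra B) (π : CliffordC V →⋆ₙₐ[ℂ] B),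
      ‖π a‖ ≤ c by
    obtain ⟨c, hc⟩ := h
    exact ⟨c, by rintro _ ⟨B, i, π, rfl⟩; exact hc B i π⟩
  have hone : ∀ (B : Type u) (_ : NonUnitalCStarAlgebra B) (π : CliffordC V →⋆ₙₐ[ℂ] B),
      ‖π 1‖ ≤ 1 := by
    intro B _ π
    have h : ‖π 1‖ = ‖π 1‖ * ‖π 1‖ := by
      conv_lhs => rw [← mul_one (1 : CliffordC V), ← star_one, star_one, map_mul]
      rw [← CStarRing.norm_star_mul_self, ← StarHomClass.map_star, star_one]
    nlinarith [norm_nonneg (π 1), sq_nonneg (‖π 1‖ - 1)]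
  have hsq : ∀ v : V, star (ι V (1 ⊗ₜ v)) * ι V (1 ⊗ₜ v) =
      ((‖v‖ ^ 2 : ℝ) : ℂ) • (1 : CliffordC V) := by
    intro v
    have h := CliffordAlgebra.ι_sq_scalar (QuadraticForm.baseChange ℂ (negNormSq V)) (1 ⊗ₜ v)
    have h' : ι V (1 ⊗ₜ v) * ι V (1 ⊗ₜ v) = algebraMap ℂ (CliffordC V)
        (QuadraticForm.baseChange ℂ (negNormSq V) (1 ⊗ₜ v)) := h
    rw [star_ι, map_one, neg_mul, h', QuadraticForm.baseChange_tmul, ← map_neg,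
      Algebra.algebraMap_eq_smul_one]
    congr 1
    simp [negNormSq, reInnerForm, ← Complex.ofReal_pow, inner_self_eq_norm_sq_to_K]
  have hvec : ∀ x : ℂ ⊗[ℝ] V, ∃ c : ℝ, ∀ (B : Type u) (_ : NonUnitalCStarAlgebra B)
      (π : CliffordC V →⋆ₙₐ[ℂ] B), ‖π (ι V x)‖ ≤ c := by
    intro x
    induction x with
    | zero => exact ⟨0, fun B _ π => by simp⟩
    | add x y hx hy =>
      obtain ⟨c, hc⟩ := hx
      obtain ⟨d, hd⟩ := hy
      refine ⟨c + d, fun B i π => ?_⟩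
      rw [map_add, map_add]
      exact (norm_add_le _ _).trans (add_le_add (hc B i π) (hd B i π))
    | tmul z v =>
      refine ⟨‖z‖ * ‖v‖, fun B i π => ?_⟩
      have hz : (z ⊗ₜ v : ℂ ⊗[ℝ] V) = z • ((1 : ℂ) ⊗ₜ v) := by
        rw [TensorProduct.smul_tmul', smul_eq_mul, mul_one]
      rw [hz, map_smul, map_smul, norm_smul]
      refine mul_le_mul_of_nonneg_left ?_ (norm_nonneg z)
      refine abs_le_of_sq_le_sq' ?_ (norm_nonneg v) |>.2
      rw [sq, ← CStarRing.norm_star_mul_self, ← StarHomClass.map_star, ← map_mul, hsq, map_smul,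
        norm_smul, Complex.norm_real, Real.norm_of_nonneg (by positivity)]
      exact mul_le_of_le_one_right (by positivity) (hone B i π)
  refine CliffordAlgebra.induction (Q := QuadraticForm.baseChange ℂ (negNormSq V))
    (C := fun a : CliffordC V => ∃ c : ℝ, ∀ (B : Type u) (_ : NonUnitalCStarAlgebra B)
      (π : CliffordC V →⋆ₙₐ[ℂ] B), ‖π a‖ ≤ c) ?_ hvec ?_ ?_ a
  · intro z
    refine ⟨‖z‖, fun B i π => ?_⟩
    change ‖π (algebraMap ℂ (CliffordC V) z)‖ ≤ ‖z‖
    rw [Algebra.algebraMap_eq_smul_one, map_smul, norm_smul]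
    exact mul_le_of_le_one_right (norm_nonneg z) (hone B i π)
  · rintro x y ⟨c, hc⟩ ⟨d, hd⟩
    refine ⟨c * d, fun B i π => ?_⟩
    refine (congrArg norm (map_mul π x y)).trans_le ?_
    exact (norm_mul_le _ _).trans (mul_le_mul (hc B i π) (hd B i π) (norm_nonneg _)
      ((norm_nonneg _).trans (hc B i π)))
  · rintro x y ⟨c, hc⟩ ⟨d, hd⟩
    refine ⟨c + d, fun B i π => ?_⟩
    refine (congrArg norm (map_add π x y)).trans_le ?_
    exact (norm_add_le _ _).trans (add_le_add (hc B i π) (hd B i π))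

/-- The C⋆-Clifford algebra `Cl(V_ℂ, q_ℂ)`: the completion of the algebraic Clifford algebra of
`(V_ℂ, q_ℂ)` with respect to `‖·‖_∞`. -/
def CStarClifford : Type u :=
  (maxCStarSeminorm (CliffordC.bddAbove_repNorms V)).Completed

instance : CStarAlgebra (CStarClifford V) :=
  inferInstanceAs (CStarAlgebra (maxCStarSeminorm (CliffordC.bddAbove_repNorms V)).Completed)

/-- The canonical map `V_ℂ → Cl(V_ℂ, q_ℂ)`. -/
def CStarClifford.ι : (ℂ ⊗[ℝ] V) →ₗ[ℂ] CStarClifford V where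
  toFun x := (maxCStarSeminorm (CliffordC.bddAbove_repNorms V)).ofDom (CliffordC.ι V x)
  map_add' x y := by rw [map_add]; exact CStarSeminorm.ofDom_add _ _ _
  map_smul' z x := by rw [map_smul]; exact CStarSeminorm.ofDom_smul _ _ _

/-- The map `a(v) = ½ (v + i J v)` from `V` to `Cl(V_ℂ, q_ℂ)`, where `J v = I • v` is the complex
structure of `V`, whereas the `i` in front of it is the one of `V_ℂ`. -/
def carMap : V →ₗ⋆[ℂ] CStarClifford V where
  toFun v := CStarClifford.ι V
    ((1 / 2 : ℂ) • ((1 : ℂ) ⊗ₜ[ℝ] v + Complex.I • ((1 : ℂ) ⊗ₜ[ℝ] (Complex.I • v))))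
  map_add' v w := by
    rw [← map_add]; congr 1
    simp only [smul_add, TensorProduct.tmul_add]; abel
  map_smul' z v := by
    rw [← map_smul]; congr 1
    obtain ⟨x, y⟩ := z
    have h1 : (⟨x, y⟩ : ℂ) • v = x • v + y • (Complex.I • v) := by
      rw [← Complex.coe_smul, ← Complex.coe_smul, smul_smul, ← add_smul, Complex.mk_eq_add_mul_I]
    have h2 : Complex.I • ((⟨x, y⟩ : ℂ) • v) = x • (Complex.I • v) - y • v := by
      rw [h1, smul_add, smul_comm _ x v, smul_comm _ y, smul_smul, Complex.I_mul_I, neg_one_smul,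
        smul_neg, sub_eq_add_neg]
    have h3 : (starRingEnd ℂ) (⟨x, y⟩ : ℂ) = (x : ℂ) - y * Complex.I := by
      apply Complex.ext <;> simp
    rw [h2, h1, h3]
    simp only [TensorProduct.tmul_add, TensorProduct.tmul_sub, TensorProduct.tmul_smul]
    generalize (1 : ℂ) ⊗ₜ[ℝ] v = e
    generalize (1 : ℂ) ⊗ₜ[ℝ] (Complex.I • v) = f
    match_scalars
    · simp only [Complex.coe_algebraMap]
      ring
    · linear_combination (y : ℂ) * (1 / 2) * Complex.I_sq

end Clifford

/-! ### CAR-representations -/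

section CAR

variable {V : Type u} [NormedAddCommGroup V] [InnerProductSpace ℂ V]
  {A : Type w} [CStarAlgebra A]

/-- The canonical anticommutation relations.  The Hermitian product `(v₁, v₂)` that is linear in
`v₁` and antilinear in `v₂` is `inner ℂ v₂ v₁` in the notation of Mathlib. -/
structure SatisfiesCAR (a : V →ₗ⋆[ℂ] A) : Prop where
  anticomm : ∀ v₁ v₂ : V, a v₁ * a v₂ + a v₂ * a v₁ = 0
  star_anticomm : ∀ v₁ v₂ : V,
    star (a v₁) * a v₂ + a v₂ * star (a v₁) = (inner ℂ v₂ v₁ : ℂ) • (1 : A)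

/-- `(a, A)` is a CAR-representation of `V`: the relations hold, and `A` is generated by `a(V)` as a
unital C⋆-algebra. -/
structure IsCARRepresentation (a : V →ₗ⋆[ℂ] A) : Prop extends SatisfiesCAR a where
  generates : (StarAlgebra.adjoin ℂ (Set.range a)).topologicalClosure = ⊤

end CAR

end

/-! ### Anticommuting families of square roots of `-1` -/

/-! The core fact is rigidity of the norm: any two unital ⋆-homomorphisms `f`, `g` from the
algebraic Clifford algebra to nonzero C⋆-algebras satisfy `‖f x‖ = ‖g x‖` for every `x`
(`CliffordC.norm_map_le`, used in both directions). An element `x` involves finitely many vectors,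
so it lies in the algebra generated by a finite-dimensional complex subspace `W`. An orthonormal
basis of `W` together with its multiples by `i` gives an even number of anticommuting square roots
of `-1`. For an even number of them the ordered products are linearly independent in every nonzero
algebra (`IsCliffordFamily.linearIndependent`), so `g` is injective on a finite-dimensional
⋆-algebra containing `x`. Its image under `g` is a C⋆-algebra, on which `f ∘ g⁻¹` is a
⋆-homomorphism and hence contractive.

Rigidity is only useful for the completion once that is known to be nonzero, so one nonzero
representation is constructed: operators with Jordan–Wigner signs on `ℓ²` of the finite subsets of a
real Hilbert basis of the completed space (`CliffordC.exists_nontrivial_starAlgHom`).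

The CAR and Clifford pictures are translated into each other by `c(v) = b(v) - b(v)*` and `b(v) = ½
(c(v) + i c(Jv))`. A map satisfying the CAR thus yields a representation of the algebraic Clifford
algebra, which by rigidity extends isometrically to the completion. Uniqueness of the extension is
density. For a CAR-representation the isometric image is closed and contains the generators, so the
extension is an isomorphism, and any two CAR-representations are compared through the Clifford
algebra. -/

/-- A family of pairwise anticommuting square roots of `-1`. -/
structure IsCliffordFamily {ι : Type*} {B : Type*} [Ring B] (e : ι → B) : Prop where
  mul_self : ∀ i, e i * e i = -1
  anticomm : ∀ i j, i ≠ j → e i * e j = -(e j * e i)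

namespace IsCliffordFamily

section Ring

variable {ι : Type*} {B : Type*} [Ring B] {e : ι → B}

theorem map {C : Type*} [Ring C] (he : IsCliffordFamily e) (f : B →+* C) :
    IsCliffordFamily (fun i => f (e i)) where
  mul_self i := by rw [← map_mul, he.mul_self, map_neg, map_one]
  anticomm i j h := by rw [← map_mul, he.anticomm i j h, map_neg, map_mul]

variable [DecidableEq ι]

/-- Passing `e i` through a letter costs a sign unless that letter is `e i` itself. The number of
signs is the length minus the count, which has the parity of their sum. -/
theorem mul_prod (he : IsCliffordFamily e) (i : ι) (L : List ι) :
    e i * (L.map e).prod = (-1) ^ (L.length + L.count i) * ((L.map e).prod * e i) := by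
  induction L with
  | nil => simp
  | cons j L ih =>
    rw [List.map_cons, List.prod_cons, List.length_cons, List.count_cons]
    rcases eq_or_ne i j with rfl | h
    · rw [if_pos (beq_self_eq_true i), show L.length + 1 + (L.count i + 1) =
        L.length + L.count i + 2 by ring, pow_add, neg_one_sq, mul_one]
      rcases neg_one_pow_eq_or B (L.length + L.count i) with h | h <;> rw [h] at ih ⊢
      · rw [ih, one_mul, one_mul, ← mul_assoc (e i), ih, one_mul]
      · rw [ih, neg_one_mul, neg_one_mul, mul_neg, ← mul_assoc (e i), ih, neg_one_mul]
    · rw [if_neg (by simpa using h.symm), add_zero, add_right_comm, pow_succ, ← mul_assoc,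
        he.anticomm i j h, neg_mul, mul_assoc (e j)]
      rcases neg_one_pow_eq_or B (L.length + L.count i) with h | h <;> rw [h] at ih ⊢ <;>
        simp [ih, mul_assoc]

/-- The first letter occurs again later in the word. Moving it next to that occurrence costs only a
sign, the two letters multiply to `-1`, and the remaining shorter word still has even counts. -/
theorem prod_eq_one_or (he : IsCliffordFamily e) (L : List ι) (h : ∀ i, Even (L.count i)) :
    (L.map e).prod = 1 ∨ (L.map e).prod = -1 := by
  induction hn : L.length using Nat.strong_induction_on generalizing L with
  | _ n ih =>
    cases L with
    | nil => simp
    | cons i L =>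
      have hi : i ∈ L := by
        by_contra hi
        have := h i
        rw [List.count_cons_self, List.count_eq_zero_of_not_mem hi] at this
        simp at this
      obtain ⟨s, t, rfl⟩ := List.append_of_mem hi
      have h' : ∀ j, Even ((s ++ t).count j) := by
        intro j
        have := h j
        simp only [List.count_cons, List.count_append] at this ⊢
        split_ifs at this <;> grind
      have key : ((i :: (s ++ i :: t)).map e).prod =
          -((-1) ^ (s.length + s.count i) * ((s ++ t).map e).prod) := by
        simp only [List.map_cons, List.map_append, List.prod_cons, List.prod_append]
        rw [← mul_assoc, he.mul_prod i s, mul_assoc, mul_assoc, ← mul_assoc (e i), he.mul_self]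
        simp
      rw [key]
      have hlt : (s ++ t).length < n := by
        rw [← hn]; simp only [List.length_cons, List.length_append]; lia
      rcases ih _ hlt (s ++ t) h' rfl with h1 | h1 <;>
        rcases neg_one_pow_eq_or B (s.length + s.count i) with h2 | h2 <;> rw [h1, h2] <;>
        simp

theorem exists_finset_prod_eq [Fintype ι] (he : IsCliffordFamily e) (L : List ι) :
    ∃ s : Finset ι, (L.map e).prod = (s.toList.map e).prod ∨
      (L.map e).prod = -(s.toList.map e).prod := by
  -- Only the letters of odd multiplicity survive. Both `L ++ L.reverse` and `L.reverse ++ s.toList`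
  -- have even counts, so both have product `±1`; bracketing the triple product in two ways compares
  -- `L` with `s`.
  refine ⟨Finset.univ.filter fun i => Odd (L.count i), ?_⟩
  set s := Finset.univ.filter fun i => Odd (L.count i) with hs
  have h1 := he.prod_eq_one_or (L ++ L.reverse) (fun i => by
    rw [List.count_append, List.count_reverse]; exact ⟨_, rfl⟩)
  have h2 := he.prod_eq_one_or (L.reverse ++ s.toList) (fun i => by
    rw [List.count_append, List.count_reverse, (Finset.nodup_toList s).count]
    by_cases hi : Odd (L.count i)
    · rw [if_pos (by simp [hs, hi])]; exact hi.add_one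
    · rw [if_neg (by simp [hs, hi])]; simpa using hi)
  rw [List.map_append, List.prod_append] at h1 h2
  have h3 : (L.map e).prod * ((L.reverse.map e).prod * (s.toList.map e).prod) =
    (L.map e).prod * (L.reverse.map e).prod * (s.toList.map e).prod := (mul_assoc _ _ _).symm
  rcases h1 with h1 | h1 <;> rcases h2 with h2 | h2 <;> rw [h1, h2] at h3 <;>
    simp only [one_mul, mul_one, neg_one_mul, mul_neg_one, neg_inj] at h3 <;>
    first
    | exact .inl h3
    | exact .inr h3
    | exact .inr (neg_eq_iff_eq_neg.mp h3)

theorem prod_ne_zero [Nontrivial B] (he : IsCliffordFamily e) (L : List ι) :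
    (L.map e).prod ≠ 0 := by
  intro h
  have h1 := he.prod_eq_one_or (L ++ L.reverse) (fun i => by
    rw [List.count_append, List.count_reverse]; exact ⟨_, rfl⟩)
  rw [List.map_append, List.prod_append, h, zero_mul] at h1
  rcases h1 with h1 | h1
  · exact one_ne_zero h1.symm
  · exact one_ne_zero (neg_eq_zero.mp h1.symm)

end Ring

section Algebra

variable {ι : Type*} [Fintype ι] [DecidableEq ι] {B : Type*} [Ring B] [Algebra ℂ B] {e : ι → B}

theorem adjoin_le_span (he : IsCliffordFamily e) :
    Subalgebra.toSubmodule (Algebra.adjoin ℂ (Set.range e)) ≤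
      Submodule.span ℂ (Set.range fun s : Finset ι => (s.toList.map e).prod) := by
  rw [Algebra.adjoin_eq_span, Submodule.span_le]
  intro x hx
  obtain ⟨l, hl, rfl⟩ := Submonoid.exists_list_of_mem_closure hx
  obtain ⟨L, rfl⟩ : ∃ L : List ι, L.map e = l := by
    rw [← Set.mem_range, Set.range_list_map]; exact hl
  obtain ⟨s, h | h⟩ := he.exists_finset_prod_eq L <;> rw [h]
  · exact Submodule.subset_span ⟨s, rfl⟩
  · exact Submodule.neg_mem _ (Submodule.subset_span ⟨s, rfl⟩)

/-- The signs determine membership in `s` up to a global flip by the parity of `s.card`. A flip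
would make `t` the complement of `s` with cardinality of the other parity, which is impossible when
the total number is even. For an odd total, the empty set and the full set have the same signs. -/
theorem sign_injective (hι : Even (Fintype.card ι)) :
    Function.Injective fun (s : Finset ι) (i : ι) =>
      (-1 : ℂ) ^ (s.card + if i ∈ s then 1 else 0) := by
  intro s t h
  have h' : ∀ i, (Even (s.card + if i ∈ s then 1 else 0) ↔
      Even (t.card + if i ∈ t then 1 else 0)) := fun i => by
    have := congrFun h i
    simp only [neg_one_pow_eq_ite] at this
    by_cases h1 : Even (s.card + if i ∈ s then 1 else 0) <;>
      by_cases h2 : Even (t.card + if i ∈ t then 1 else 0) <;>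
      simp only [h1, h2, if_true, if_false] at this <;> norm_num at this <;> simp [h1, h2]
  by_cases hst : Even s.card ↔ Even t.card
  · ext i
    have := h' i
    simp only [Nat.even_add, hst] at this
    by_cases h1 : i ∈ s <;> by_cases h2 : i ∈ t <;> by_cases h3 : Even t.card <;>
      simp [h1, h2, h3] at this ⊢
  · exfalso
    have : t = sᶜ := by
      ext i
      have := h' i
      simp only [Nat.even_add] at this
      rw [Finset.mem_compl]
      by_cases h1 : i ∈ s <;> by_cases h2 : i ∈ t <;> by_cases h3 : Even s.card <;>
        by_cases h4 : Even t.card <;> simp [h1, h2, h3, h4] at this hst ⊢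
    have h3 := s.card_add_card_compl
    rw [← this] at h3
    rw [← h3, Nat.even_add] at hι
    exact hst hι

/-- The operators `f i` are conjugations by `e i`, since the inverse of `e i` is `-e i`. They
commute, and the ordered products are nonzero joint eigenvectors whose systems of eigenvalues are
distinct by `sign_injective`. -/
theorem linearIndependent (he : IsCliffordFamily e) [Nontrivial B] (hι : Even (Fintype.card ι)) :
    LinearIndependent ℂ fun s : Finset ι => (s.toList.map e).prod := by
  let f : ι → Module.End ℂ B := fun i =>
    -(LinearMap.mulLeft ℂ (e i) ∘ₗ LinearMap.mulRight ℂ (e i))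
  have hf : ∀ i x, f i x = -(e i * (x * e i)) := fun _ _ => rfl
  have hcomm : ∀ i j, Commute (f i) (f j) := by
    intro i j
    rcases eq_or_ne i j with rfl | h
    · exact Commute.refl _
    · ext x
      simp only [Module.End.mul_apply, hf]
      have h1 : e j * e i = -(e i * e j) := by rw [he.anticomm i j h, neg_neg]
      simp only [mul_neg, neg_mul, neg_neg, mul_assoc, h1]
      simp only [← mul_assoc, h1, neg_mul]
  have hind := Module.End.independent_iInf_maxGenEigenspace_of_forall_mapsTo f
    (fun i j φ => Module.End.mapsTo_maxGenEigenspace_of_comm (hcomm j i) φ)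
  refine (hind.comp (sign_injective hι)).linearIndependent _ (fun s => ?_) fun s =>
    he.prod_ne_zero _
  rw [Function.comp_apply, Submodule.mem_iInf]
  intro i
  refine Module.End.eigenspace_le_maxGenEigenspace (Module.End.mem_eigenspace_iff.mpr ?_)
  rw [hf, ← mul_assoc, he.mul_prod, Finset.length_toList, (Finset.nodup_toList s).count]
  simp only [Finset.mem_toList]
  rw [mul_assoc, mul_assoc, he.mul_self, mul_neg_one, mul_neg, neg_neg, Algebra.smul_def, map_pow,
    map_neg, map_one]

/-- This plays the role of simplicity of the even complex Clifford algebras. The image family is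
again a Clifford family, so its products are independent in `C` and every coefficient of `x`
vanishes. -/
theorem eq_zero_of_map_eq_zero (he : IsCliffordFamily e) (hι : Even (Fintype.card ι))
    {C : Type*} [Ring C] [Algebra ℂ C] [Nontrivial C] (f : B →ₐ[ℂ] C) {x : B}
    (hx : x ∈ Algebra.adjoin ℂ (Set.range e)) (h : f x = 0) : x = 0 := by
  obtain ⟨c, rfl⟩ := (Submodule.mem_span_range_iff_exists_fun ℂ).mp (he.adjoin_le_span hx)
  have hl := (he.map f.toRingHom).linearIndependent (B := C) hι
  rw [Fintype.linearIndependent_iff] at hl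
  have hc := hl c (by
    rw [← h, map_sum]
    refine Finset.sum_congr rfl fun s _ => ?_
    rw [map_smul, map_list_prod, List.map_map]; rfl)
  simp [hc]

end Algebra

end IsCliffordFamily

/-! ### Comparison of C⋆-norms on finite-dimensional ⋆-algebras -/

section NormComparison

variable {A : Type*} [Ring A] [StarRing A] [Algebra ℂ A] [StarModule ℂ A]
  {B : Type*} [CStarAlgebra B] {C : Type*} [CStarAlgebra C]

/-- Although `F` carries no norm, its injective image under `g` is finite-dimensional, hence closed,
hence a C⋆-algebra. There `f ∘ g⁻¹` is a ⋆-homomorphism between C⋆-algebras and so contractive. -/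
theorem StarSubalgebra.norm_map_le_of_finiteDimensional (F : StarSubalgebra ℂ A)
    [FiniteDimensional ℂ F] (f : A →⋆ₐ[ℂ] B) (g : A →⋆ₐ[ℂ] C)
    (hg : ∀ x ∈ F, g x = 0 → x = 0) {x : A} (hx : x ∈ F) : ‖f x‖ ≤ ‖g x‖ := by
  let g' : F →⋆ₐ[ℂ] C := g.comp F.subtype
  have hinj : Function.Injective g' := by
    refine (injective_iff_map_eq_zero g').mpr fun y hy => ?_
    exact Subtype.ext (hg y y.2 hy)
  let e := StarAlgEquiv.ofInjective g' hinj
  have hfin : FiniteDimensional ℂ (Subalgebra.toSubmodule g'.range.toSubalgebra) :=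
    LinearEquiv.finiteDimensional e.toAlgEquiv.toLinearEquiv
  have : IsClosed (g'.range : Set C) :=
    (Subalgebra.toSubmodule g'.range.toSubalgebra).closed_of_finiteDimensional
  let h : g'.range →⋆ₐ[ℂ] B := (f.comp F.subtype).comp (e.symm : g'.range →⋆ₐ[ℂ] F)
  have h1 : h (e ⟨x, hx⟩) = f x := by
    change f (F.subtype (e.symm (e ⟨x, hx⟩))) = f x
    rw [e.symm_apply_apply]; rfl
  have h2 := NonUnitalStarAlgHom.norm_apply_le h (e ⟨x, hx⟩)
  rw [h1] at h2
  exact h2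

theorem IsCliffordFamily.norm_map_le {ι : Type*} [Fintype ι] {e : ι → A} (he : IsCliffordFamily e)
    (hι : Even (Fintype.card ι)) (hstar : ∀ i, star (e i) = -e i) [Nontrivial C] (f : A →⋆ₐ[ℂ] B)
    (g : A →⋆ₐ[ℂ] C) {x : A} (hx : x ∈ Algebra.adjoin ℂ (Set.range e)) : ‖f x‖ ≤ ‖g x‖ := by
  classical
  -- Skew-adjoint generators make the generated algebra closed under star, so the span of the
  -- finitely many ordered products contains the whole ⋆-algebra.
  have hle : (StarAlgebra.adjoin ℂ (Set.range e)).toSubalgebra ≤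
      Algebra.adjoin ℂ (Set.range e) := by
    rw [StarAlgebra.adjoin_toSubalgebra, Algebra.adjoin_le_iff]
    rintro y (hy | hy)
    · exact Algebra.subset_adjoin hy
    · obtain ⟨i, hi⟩ := Set.mem_star.mp hy
      rw [← star_star y, ← hi, hstar]
      exact Subalgebra.neg_mem _ (Algebra.subset_adjoin ⟨i, rfl⟩)
  have : FiniteDimensional ℂ (StarAlgebra.adjoin ℂ (Set.range e)) := by
    have : FiniteDimensional ℂ (Submodule.span ℂ
      (Set.range fun s : Finset ι => (s.toList.map e).prod)) :=
      FiniteDimensional.span_of_finite ℂ (Set.finite_range _)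
    exact Submodule.finiteDimensional_of_le
      (S₁ := Subalgebra.toSubmodule (StarAlgebra.adjoin ℂ (Set.range e)).toSubalgebra)
      (fun y hy => he.adjoin_le_span (hle hy))
  refine (StarAlgebra.adjoin ℂ (Set.range e)).norm_map_le_of_finiteDimensional f g
    (fun y hy h => he.eq_zero_of_map_eq_zero hι (g : A →ₐ[ℂ] C) (hle hy) h) ?_
  exact Algebra.adjoin_le (StarAlgebra.subset_adjoin ℂ (Set.range e)) hx

end NormComparison

/-! ### ⋆-homomorphisms on the algebraic Clifford algebra -/

namespace CliffordC

variable {V : Type u} [NormedAddCommGroup V] [InnerProductSpace ℂ V]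

section Lift

variable {B : Type w} [CStarAlgebra B] (c : V →ₗ[ℝ] B)

theorem map_mul_self_eq_algebraMap (hc : ∀ v, c v * c v = -((‖v‖ ^ 2 : ℝ) • (1 : B))) (v : V) :
    c v * c v = algebraMap ℝ B (negNormSq V v) := by
  rw [hc, Algebra.algebraMap_eq_smul_one, ← neg_smul]
  congr 1
  simp [negNormSq, reInnerForm, ← Complex.ofReal_pow, inner_self_eq_norm_sq_to_K]

/-- The homomorphism on the real Clifford algebra of `V` induced by a real-linear map whose values
have the prescribed squares. -/
noncomputable def liftReal (hc : ∀ v, c v * c v = -((‖v‖ ^ 2 : ℝ) • (1 : B))) :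
    CliffordAlgebra (negNormSq V) →ₐ[ℝ] B :=
  CliffordAlgebra.lift (negNormSq V) ⟨c, map_mul_self_eq_algebraMap c hc⟩

theorem liftReal_star (hc : ∀ v, c v * c v = -((‖v‖ ^ 2 : ℝ) • (1 : B)))
    (hstar : ∀ v, star (c v) = -c v) (x : CliffordAlgebra (negNormSq V)) :
    liftReal c hc (star x) = star (liftReal c hc x) := by
  induction x using CliffordAlgebra.induction with
  | algebraMap r =>
    rw [CliffordAlgebra.star_algebraMap, AlgHom.commutes, Algebra.algebraMap_eq_smul_one, star_smul,
      star_one, star_trivial]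
  | ι v =>
    rw [CliffordAlgebra.star_ι, map_neg, liftReal, CliffordAlgebra.lift_ι_apply]
    exact (hstar v).symm
  | mul a b ha hb => rw [star_mul, map_mul, map_mul, star_mul, ha, hb]
  | add a b ha hb => rw [star_add, map_add, map_add, star_add, ha, hb]

/-- The homomorphism on the complexified real Clifford algebra of `V` induced by a real-linear map
whose values have the prescribed squares. -/
noncomputable def liftTensor (hc : ∀ v, c v * c v = -((‖v‖ ^ 2 : ℝ) • (1 : B))) :
    ℂ ⊗[ℝ] CliffordAlgebra (negNormSq V) →ₐ[ℂ] B :=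
  Algebra.TensorProduct.lift (Algebra.ofId ℂ B) (liftReal c hc)
    fun z x => by rw [Algebra.ofId_apply]; exact Algebra.commute_algebraMap_left z _

theorem liftTensor_tmul (hc : ∀ v, c v * c v = -((‖v‖ ^ 2 : ℝ) • (1 : B))) (z : ℂ)
    (x : CliffordAlgebra (negNormSq V)) : liftTensor c hc (z ⊗ₜ x) = z • liftReal c hc x := by
  rw [liftTensor, Algebra.TensorProduct.lift_tmul, Algebra.smul_def]; rfl

/-- The ⋆-homomorphism on the Clifford algebra induced by a real-linear map with skew-adjoint values
that have the prescribed squares. -/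
noncomputable def lift (hc : ∀ v, c v * c v = -((‖v‖ ^ 2 : ℝ) • (1 : B)))
    (hstar : ∀ v, star (c v) = -c v) : CliffordC V →⋆ₐ[ℂ] B where
  __ := (liftTensor c hc).comp (equivTensor V : CliffordC V →ₐ[ℂ] _)
  map_star' x := by
    change liftTensor c hc (equivTensor V (star x)) = star (liftTensor c hc (equivTensor V x))
    rw [star_def, AlgEquiv.apply_symm_apply]
    induction equivTensor V x with
    | zero => simp
    | tmul z x =>
      rw [TensorProduct.star_tmul, liftTensor_tmul, liftTensor_tmul, liftReal_star c hc hstar,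
        star_smul]
    | add a b ha hb => rw [star_add, map_add, map_add, star_add, ha, hb]

theorem lift_ι (hc : ∀ v, c v * c v = -((‖v‖ ^ 2 : ℝ) • (1 : B)))
    (hstar : ∀ v, star (c v) = -c v) (z : ℂ) (v : V) :
    lift c hc hstar (ι V (z ⊗ₜ v)) = z • c v := by
  change liftTensor c hc (equivTensor V (ι V (z ⊗ₜ v))) = _
  rw [equivTensor_ι, liftTensor_tmul, liftReal, CliffordAlgebra.lift_ι_apply]

end Lift

theorem ι_tmul (z : ℂ) (v : V) : ι V (z ⊗ₜ v) = z • ι V (1 ⊗ₜ v) := by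
  rw [← map_smul, TensorProduct.smul_tmul', smul_eq_mul, mul_one]

@[elab_as_elim]
theorem induction {P : CliffordC V → Prop} (h_smul : ∀ z : ℂ, P (z • 1))
    (h_ι : ∀ v : V, P (ι V (1 ⊗ₜ v))) (h_mul : ∀ x y, P x → P y → P (x * y))
    (h_add : ∀ x y, P x → P y → P (x + y)) (x : CliffordC V) : P x := by
  refine CliffordAlgebra.induction (Q := QuadraticForm.baseChange ℂ (negNormSq V))
    (C := P) (fun z => ?_) (fun t => ?_) h_mul h_add x
  · have := h_smul z
    rwa [← Algebra.algebraMap_eq_smul_one] at this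
  · change P (ι V t)
    induction t with
    | zero => simpa using h_smul 0
    | tmul z v =>
      rw [ι_tmul, ← smul_one_mul]
      exact h_mul _ _ (h_smul z) (h_ι v)
    | add a b ha hb => rw [map_add]; exact h_add _ _ ha hb

theorem exists_finiteDimensional_mem_adjoin (x : CliffordC V) :
    ∃ W : Submodule ℂ V, FiniteDimensional ℂ W ∧
      x ∈ Algebra.adjoin ℂ ((fun v : V => ι V (1 ⊗ₜ v)) '' W) := by
  have hmono : ∀ {W W' : Submodule ℂ V}, W ≤ W' →
      Algebra.adjoin ℂ ((fun v : V => ι V (1 ⊗ₜ v)) '' W) ≤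
        Algebra.adjoin ℂ ((fun v : V => ι V (1 ⊗ₜ v)) '' W') := fun h =>
    Algebra.adjoin_mono (Set.image_mono h)
  induction x using induction with
  | h_smul z => exact ⟨⊥, inferInstance, Subalgebra.smul_mem _ (one_mem _) z⟩
  | h_ι v =>
    exact ⟨Submodule.span ℂ {v}, inferInstance,
      Algebra.subset_adjoin ⟨v, Submodule.mem_span_singleton_self v, rfl⟩⟩
  | h_mul x y hx hy =>
    obtain ⟨W, hW, hx⟩ := hx
    obtain ⟨W', hW', hy⟩ := hy
    exact ⟨W ⊔ W', inferInstance, mul_mem (hmono le_sup_left hx) (hmono le_sup_right hy)⟩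
  | h_add x y hx hy =>
    obtain ⟨W, hW, hx⟩ := hx
    obtain ⟨W', hW', hy⟩ := hy
    exact ⟨W ⊔ W', inferInstance, add_mem (hmono le_sup_left hx) (hmono le_sup_right hy)⟩

theorem ι_one_tmul_mul_add_swap (v w : V) :
    ι V (1 ⊗ₜ v) * ι V (1 ⊗ₜ w) + ι V (1 ⊗ₜ w) * ι V (1 ⊗ₜ v) =
      ((-2 * (inner ℂ v w).re : ℝ) : ℂ) • (1 : CliffordC V) := by
  rw [ι_mul_ι_add_swap, Algebra.algebraMap_eq_smul_one, qC, LinearMap.BilinForm.baseChange_tmul]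
  congr 1
  simp [reInnerForm]

theorem isCliffordFamily_ι {κ : Type*} (e : κ → V) (h1 : ∀ i, ‖e i‖ = 1)
    (h2 : ∀ i j, i ≠ j → (inner ℂ (e i) (e j)).re = 0) :
    IsCliffordFamily fun i => ι V (1 ⊗ₜ e i) where
  mul_self i := by
    have h := ι_one_tmul_mul_add_swap (e i) (e i)
    rw [← two_smul ℂ, show (inner ℂ (e i) (e i)).re = 1 by
      rw [inner_self_eq_norm_sq_to_K, h1]; simp] at h
    have h' := congrArg (fun t => (2⁻¹ : ℂ) • t) h
    simp only [smul_smul] at h'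
    norm_num at h'
    exact h'
  anticomm i j h := by
    have := ι_one_tmul_mul_add_swap (e i) (e j)
    rw [h2 i j h] at this
    simpa using eq_neg_of_add_eq_zero_left (by simpa using this)

/-- Only the codomain of `g` has to be nonzero. When both are, exchanging `f` and `g` gives equality
of norms. -/
theorem norm_map_le {B : Type*} [CStarAlgebra B] {C : Type*} [CStarAlgebra C] [Nontrivial C]
    (f : CliffordC V →⋆ₐ[ℂ] B) (g : CliffordC V →⋆ₐ[ℂ] C) (x : CliffordC V) : ‖f x‖ ≤ ‖g x‖ := by
  obtain ⟨W, hW, hx⟩ := exists_finiteDimensional_mem_adjoin x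
  let b := stdOrthonormalBasis ℂ W
  -- An orthonormal basis of `W` for the real part of the inner product. Since `W` is a complex
  -- subspace, its cardinality is even.
  let e : Fin (Module.finrank ℂ W) × Bool → V := fun k =>
    bif k.2 then Complex.I • (b k.1 : V) else b k.1
  have hb : ∀ i j, inner ℂ (b i : V) (b j : V) = if i = j then 1 else 0 := fun i j => by
    rw [← Submodule.coe_inner, orthonormal_iff_ite.mp b.orthonormal]
  have he : IsCliffordFamily fun k => ι V (1 ⊗ₜ e k) := by
    refine isCliffordFamily_ι e ?_ ?_
    · have hn : ∀ i, ‖(b i : V)‖ = 1 := b.orthonormal.1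
      rintro ⟨i, _ | _⟩ <;> simp [e, norm_smul, hn]
    · rintro ⟨i, _ | _⟩ ⟨j, _ | _⟩ hij <;> simp [e, hb] at hij ⊢
      · simp [hij]
      · split_ifs <;> simp
      · split_ifs <;> simp
      · simp [hij]
  refine he.norm_map_le (by simp) (fun k => ?_) f g ?_
  · rw [star_ι, map_one]
  · refine Algebra.adjoin_le ?_ hx
    rintro _ ⟨v, hv, rfl⟩
    have h := congrArg (Subtype.val) (b.sum_repr ⟨v, hv⟩)
    simp only [Submodule.coe_sum, Submodule.coe_smul] at h
    rw [SetLike.mem_coe, ← h]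
    dsimp only
    rw [TensorProduct.tmul_sum, map_sum]
    refine Subalgebra.sum_mem _ fun i _ => ?_
    set z := b.repr ⟨v, hv⟩ i
    have hz : z • (b i : V) = z.re • e (i, false) + z.im • e (i, true) := by
      conv_lhs => rw [← Complex.re_add_im z]
      simp only [e, cond_true, cond_false, add_smul, mul_smul, Complex.coe_smul]
    rw [hz, TensorProduct.tmul_add, map_add, ← TensorProduct.smul_tmul, ← TensorProduct.smul_tmul,
      ι_tmul, ι_tmul (z.im • 1)]
    have hmem : ∀ k, ι V (1 ⊗ₜ e k) ∈ Algebra.adjoin ℂ (Set.range fun k => ι V (1 ⊗ₜ e k)) :=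
      fun k => Algebra.subset_adjoin (Set.mem_range_self k)
    exact add_mem (Subalgebra.smul_mem _ (hmem _) _) (Subalgebra.smul_mem _ (hmem _) _)

end CliffordC

/-! ### Sums over anticommuting families -/

theorem IsCliffordFamily.sum_smul_mul_self {κ : Type*} {B : Type*} [Ring B] [Algebra ℝ B]
    {e : κ → B} (he : IsCliffordFamily e) (c : κ → ℝ) (F : Finset κ) :
    (∑ j ∈ F, c j • e j) * (∑ j ∈ F, c j • e j) = -((∑ j ∈ F, c j ^ 2) • (1 : B)) := by
  classical
  induction F using Finset.induction_on with
  | empty => simp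
  | insert a F ha ih =>
    have hcomm : (c a • e a) * (∑ j ∈ F, c j • e j) = -((∑ j ∈ F, c j • e j) * (c a • e a)) := by
      rw [Finset.mul_sum, Finset.sum_mul, ← Finset.sum_neg_distrib]
      refine Finset.sum_congr rfl fun j hj => ?_
      rw [smul_mul_smul_comm, smul_mul_smul_comm, he.anticomm a j (by rintro rfl; exact ha hj),
        smul_neg, mul_comm]
    rw [Finset.sum_insert ha, Finset.sum_insert ha, add_mul, mul_add, mul_add, ih, hcomm,
      smul_mul_smul_comm, he.mul_self, add_smul, ← sq, smul_neg]
    abel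

section Series

variable {κ : Type*} {B : Type*} [CStarAlgebra B] {e : κ → B}

/-- The sum is skew-adjoint, so its `star x * x` is `-x²`, a scalar because the cross terms cancel.
Equality may fail only when `B` is zero. -/
theorem IsCliffordFamily.norm_sum_smul_sq_le (he : IsCliffordFamily e)
    (hstar : ∀ i, star (e i) = -e i) (c : κ → ℝ) (F : Finset κ) :
    ‖∑ j ∈ F, c j • e j‖ ^ 2 ≤ ∑ j ∈ F, c j ^ 2 := by
  have h : star (∑ j ∈ F, c j • e j) = -∑ j ∈ F, c j • e j := by
    rw [star_sum, ← Finset.sum_neg_distrib]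
    refine Finset.sum_congr rfl fun j _ => ?_
    rw [star_smul, hstar, star_trivial, smul_neg]
  rw [sq, ← CStarRing.norm_star_mul_self, h, neg_mul, he.sum_smul_mul_self, neg_neg]
  have h0 : 0 ≤ ∑ j ∈ F, c j ^ 2 := Finset.sum_nonneg fun _ _ => sq_nonneg _
  refine (norm_smul_le _ _).trans ?_
  rw [Real.norm_of_nonneg h0]
  refine mul_le_of_le_one_right h0 ?_
  rcases subsingleton_or_nontrivial B with _ | _
  · rw [Subsingleton.elim (1 : B) 0, norm_zero]; exact zero_le_one
  · exact CStarRing.norm_one.le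

theorem IsCliffordFamily.summable_smul (he : IsCliffordFamily e)
    (hstar : ∀ i, star (e i) = -e i) {c : κ → ℝ} (hc : Summable fun j => c j ^ 2) :
    Summable fun j => c j • e j := by
  rw [summable_iff_vanishing_norm] at hc ⊢
  intro ε hε
  obtain ⟨s, hs⟩ := hc (ε ^ 2) (by positivity)
  refine ⟨s, fun t ht => ?_⟩
  have h1 := (he.norm_sum_smul_sq_le hstar c t).trans_lt ((le_abs_self _).trans_lt (hs t ht))
  exact lt_of_pow_lt_pow_left₀ 2 hε.le h1

theorem IsCliffordFamily.tsum_smul_mul_self (he : IsCliffordFamily e)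
    (hstar : ∀ i, star (e i) = -e i) {c : κ → ℝ} {r : ℝ} (hc : HasSum (fun j => c j ^ 2) r) :
    (∑' j, c j • e j) * (∑' j, c j • e j) = -(r • (1 : B)) := by
  have h := (he.summable_smul hstar hc.summable).hasSum
  refine tendsto_nhds_unique (Filter.Tendsto.mul h h) ?_
  simp_rw [he.sum_smul_mul_self]
  exact (Filter.Tendsto.smul_const hc 1).neg

end Series

/-! ### Signed permutations of coordinates in `ℓ²` -/

section SignedPermutation

variable {X : Type u}

/-- The operator `f ↦ (x ↦ s x * f (σ x))` on `ℓ²(X)` for a permutation `σ` and signs `s`. -/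
noncomputable def signedPerm (σ : Equiv.Perm X) (s : X → ℤˣ) :
    lp (fun _ : X => ℂ) 2 →ₗᵢ[ℂ] lp (fun _ : X => ℂ) 2 :=
  have hnorm : ∀ (f : lp (fun _ : X => ℂ) 2) (x : X), ‖((s x : ℤ) : ℂ) * f (σ x)‖ = ‖f (σ x)‖ :=
    fun f x => by rcases Int.units_eq_one_or (s x) with h | h <;> simp [h]
  have h2 : 0 < (2 : ENNReal).toReal := by norm_num
  { toFun f := ⟨fun x => ((s x : ℤ) : ℂ) * f (σ x), (memℓp_gen_iff h2).mpr (by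
      simp_rw [hnorm]
      exact σ.summable_iff.mpr ((memℓp_gen_iff h2).mp (lp.memℓp f)))⟩
    map_add' f g := by ext x; exact mul_add _ _ _
    map_smul' z f := by ext x; simp [mul_left_comm]
    norm_map' f := by
      rw [lp.norm_eq_tsum_rpow h2, lp.norm_eq_tsum_rpow h2]
      congr 1
      rw [← σ.tsum_eq fun x => ‖f x‖ ^ (2 : ENNReal).toReal]
      exact tsum_congr fun x => congrArg (· ^ (2 : ENNReal).toReal) (hnorm f x) }

theorem signedPerm_apply (σ : Equiv.Perm X) (s : X → ℤˣ) (f : lp (fun _ : X => ℂ) 2) (x : X) :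
    signedPerm σ s f x = ((s x : ℤ) : ℂ) * f (σ x) := rfl

/-- The adjoint of a signed permutation operator belongs to the inverse permutation, here `σ`
itself, with signs `s ∘ σ`, which are `-s`. -/
theorem star_signedPerm (σ : Equiv.Perm X) (s : X → ℤˣ) (hσ : ∀ x, σ (σ x) = x)
    (hs : ∀ x, s (σ x) = -s x) :
    star (signedPerm σ s).toContinuousLinearMap = -(signedPerm σ s).toContinuousLinearMap := by
  rw [ContinuousLinearMap.star_eq_adjoint]
  refine ((ContinuousLinearMap.eq_adjoint_iff _ _).mpr fun f g => ?_).symm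
  rw [lp.inner_eq_tsum, lp.inner_eq_tsum, ← σ.tsum_eq]
  refine tsum_congr fun x => ?_
  change inner ℂ (-(signedPerm σ s f (σ x))) (g (σ x)) = inner ℂ (f x) (signedPerm σ s g x)
  rw [signedPerm_apply, signedPerm_apply, hσ, hs]
  simp
  ring

end SignedPermutation

/-! ### The Clifford family indexed by a linear order on `ℓ²` of its finite subsets -/

section Model

variable {κ : Type u} [LinearOrder κ]

/-- The sign `(-1) ^ #{k ∈ S | k ≤ j}`. -/
noncomputable def orderSign (j : κ) (S : Finset κ) : ℤˣ := ∏ k ∈ S, if k ≤ j then -1 else 1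

theorem orderSign_symmDiff (i j : κ) (S : Finset κ) :
    orderSign j (symmDiff S {i}) = (if i ≤ j then -1 else 1) * orderSign j S := by
  by_cases hi : i ∈ S
  · have h1 : symmDiff S {i} = S.erase i := by ext k; simp [Finset.mem_symmDiff]; grind
    rw [h1, orderSign, orderSign, ← Finset.mul_prod_erase S _ hi, ← mul_assoc, Int.units_mul_self,
      one_mul]
  · have h1 : symmDiff S {i} = insert i S := by ext k; simp [Finset.mem_symmDiff]; grind
    rw [h1, orderSign, orderSign, Finset.prod_insert hi]

/-- The permutation of the finite subsets of `κ` that toggles membership of `j`. -/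
noncomputable def togglePerm (j : κ) : Equiv.Perm (Finset κ) :=
  Function.Involutive.toPerm (fun S => symmDiff S {j}) fun _ => symmDiff_symmDiff_cancel_right _ _

/-- Pairwise anticommuting skew-adjoint unitary operators, indexed by a linear order. -/
noncomputable def modelFamily (j : κ) :
    lp (fun _ : Finset κ => ℂ) 2 →L[ℂ] lp (fun _ : Finset κ => ℂ) 2 :=
  (signedPerm (togglePerm j) (orderSign j)).toContinuousLinearMap

theorem modelFamily_mul_apply (i j : κ) (f : lp (fun _ : Finset κ => ℂ) 2) (S : Finset κ) :
    (modelFamily i * modelFamily j) f S =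
      (((if i ≤ j then -1 else 1) * orderSign i S * orderSign j S : ℤˣ) : ℤ) *
        f (symmDiff (symmDiff S {i}) {j}) := by
  change ((orderSign i S : ℤ) : ℂ) * (((orderSign j (symmDiff S {i}) : ℤ) : ℂ) *
    f (symmDiff (symmDiff S {i}) {j})) = _
  rw [orderSign_symmDiff]
  push_cast
  ring

/-- Exchanging the two operators replaces the sign governed by `i ≤ j` with that governed by `j ≤
i`. Exactly one of these holds for `i ≠ j`, whence anticommutation; `j ≤ j` always holds, whence the
square `-1`. -/
theorem isCliffordFamily_modelFamily :
    IsCliffordFamily (modelFamily : κ → lp (fun _ : Finset κ => ℂ) 2 →L[ℂ] _) where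
  mul_self j := by
    ext f S
    rw [modelFamily_mul_apply, if_pos le_rfl, mul_assoc, Int.units_mul_self,
      symmDiff_symmDiff_cancel_right]
    simp
  anticomm i j h := by
    ext f S
    change _ = -((modelFamily j * modelFamily i) f S)
    rw [modelFamily_mul_apply, modelFamily_mul_apply, symmDiff_right_comm]
    rcases lt_or_gt_of_ne h with h | h
    · rw [if_pos h.le, if_neg h.not_ge]; push_cast; ring
    · rw [if_pos h.le, if_neg h.not_ge]; push_cast; ring

theorem star_modelFamily (j : κ) : star (modelFamily j) = -modelFamily j :=
  star_signedPerm _ _ (fun _ => symmDiff_symmDiff_cancel_right _ _) fun S => by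
    refine (orderSign_symmDiff j j S).trans ?_
    rw [if_pos le_rfl, neg_one_mul]

end Model

/-! ### A nonzero representation of the algebraic Clifford algebra -/

namespace CliffordC

variable {V : Type u} [NormedAddCommGroup V] [InnerProductSpace ℂ V]

/-- The representation sends `v` to `∑ c j v • e j`. The Parseval identity `hc` gives both its
convergence and the Clifford relation. -/
theorem nonempty_starAlgHom_of_isCliffordFamily {B : Type*} [CStarAlgebra B] {κ : Type*} {e : κ → B}
    (he : IsCliffordFamily e) (hstar : ∀ j, star (e j) = -e j) (c : κ → V →ₗ[ℝ] ℝ)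
    (hc : ∀ v, HasSum (fun j => c j v ^ 2) (‖v‖ ^ 2)) : Nonempty (CliffordC V →⋆ₐ[ℂ] B) := by
  have hs := fun v => he.summable_smul hstar (hc v).summable
  let Γ : V →ₗ[ℝ] B :=
    { toFun v := ∑' j, c j v • e j
      map_add' v w := by
        rw [← (hs v).tsum_add (hs w)]
        exact tsum_congr fun j => by rw [map_add, add_smul]
      map_smul' r v := by
        rw [RingHom.id_apply, ← (hs v).tsum_const_smul]
        exact tsum_congr fun j => by rw [map_smul, smul_eq_mul, mul_smul] }
  refine ⟨lift Γ (fun v => he.tsum_smul_mul_self hstar (hc v)) fun v => ?_⟩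
  change star (∑' j, c j v • e j) = -∑' j, c j v • e j
  rw [tsum_star, ← tsum_neg]
  exact tsum_congr fun j => by rw [star_smul, hstar, star_trivial, smul_neg]

variable (V)

/-- The target lives in the universe of `V`, so it is among the algebras over which the supremum
`maxCStarNorm` is taken. -/
theorem exists_nontrivial_starAlgHom :
    ∃ (B : Type u) (_ : CStarAlgebra B) (_ : Nontrivial B), Nonempty (CliffordC V →⋆ₐ[ℂ] B) := by
  -- Parseval requires a Hilbert basis, which `V` itself may not have. It is taken over `ℝ` because
  -- the Clifford form is the real part of the inner product.
  let H := UniformSpace.Completion V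
  let _ : InnerProductSpace ℝ H := InnerProductSpace.rclikeToReal ℂ H
  obtain ⟨κ, b, -⟩ := exists_hilbertBasis ℝ H
  let _ : LinearOrder κ := IsWellOrder.linearOrder WellOrderingRel
  let E := lp (fun _ : Finset κ => ℂ) 2
  have : Nontrivial E := ⟨lp.single 2 ∅ 1, 0, fun h => by
    have := congrArg (fun f : E => f ∅) h
    simp at this⟩
  refine ⟨E →L[ℂ] E, inferInstance, inferInstance,
    nonempty_starAlgHom_of_isCliffordFamily isCliffordFamily_modelFamily star_modelFamily
      (fun j =>
        { toFun v := inner ℝ (b j) (v : H)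
          map_add' v w := by rw [UniformSpace.Completion.coe_add, inner_add_right]
          map_smul' r v := by
            rw [← Complex.coe_smul, UniformSpace.Completion.coe_smul, Complex.coe_smul,
              inner_smul_right]
            rfl })
      fun v => ?_⟩
  have := b.hasSum_inner_mul_inner (v : H) (v : H)
  rw [real_inner_self_eq_norm_sq, UniformSpace.Completion.norm_coe] at this
  refine this.congr_fun fun j => ?_
  change inner ℝ (b j) (v : H) ^ 2 = _
  rw [real_inner_comm, sq]

end CliffordC

/-! ### The universal property of a C⋆-completion -/

theorem continuous_starAlgHom {A B : Type*} [CStarAlgebra A] [CStarAlgebra B] (φ : A →⋆ₐ[ℂ] B) :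
    Continuous φ :=
  AddMonoidHomClass.continuous_of_bound φ 1 fun a => by
    rw [one_mul]; exact NonUnitalStarAlgHom.norm_apply_le φ a

namespace CStarSeminorm

variable {A : Type u} [Ring A] [StarRing A] [Algebra ℂ A] [StarModule ℂ A] (p : CStarSeminorm A)

/-- The canonical ⋆-homomorphism of a ⋆-algebra to its completion. -/
noncomputable def ofDomHom : A →⋆ₐ[ℂ] p.Completed where
  toFun := p.ofDom
  map_one' := p.ofDom_one
  map_mul' := p.ofDom_mul
  map_zero' := UniformSpace.Completion.coe_zero (α := p.Dom)
  map_add' := p.ofDom_add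
  commutes' z := by
    rw [Algebra.algebraMap_eq_smul_one, Algebra.algebraMap_eq_smul_one, ofDom_smul, ofDom_one]
  map_star' := p.ofDom_star

variable {B : Type w} [CStarAlgebra B]

theorem exists_extension (g : A →⋆ₐ[ℂ] B) (hg : ∀ a, ‖g a‖ ≤ p.toRingSeminorm a) :
    ∃ φ : p.Completed →⋆ₐ[ℂ] B, ∀ a, φ (p.ofDom a) = g a := by
  let g' : p.Dom →+* B := (g : A →+* B)
  have hcont : Continuous g' :=
    AddMonoidHomClass.continuous_of_bound g' 1 fun a => by rw [one_mul]; exact hg a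
  let F : p.Completed →+* B := UniformSpace.Completion.extensionHom g' hcont
  have hFc : Continuous F := UniformSpace.Completion.continuous_extension
  have hF : ∀ a, F (p.ofDom a) = g a := UniformSpace.Completion.extensionHom_coe g' hcont
  have hstar := p.continuous_star_completed
  refine ⟨{ F with
    commutes' := fun z => ?_
    map_star' := fun x => ?_ }, hF⟩
  · change F (algebraMap ℂ p.Completed z) = algebraMap ℂ B z
    rw [← AlgHomClass.commutes p.ofDomHom z, ← AlgHomClass.commutes g z]
    exact hF _
  · change F (star x) = star (F x)
    refine induction_completed p x (isClosed_eq (hFc.comp hstar) hFc.star) fun a => ?_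
    rw [← ofDom_star, hF, hF, StarHomClass.map_star]

theorem hom_ext {φ ψ : p.Completed →⋆ₐ[ℂ] B} (h : ∀ a, φ (p.ofDom a) = ψ (p.ofDom a)) : φ = ψ := by
  ext x
  exact induction_completed p x (isClosed_eq (continuous_starAlgHom φ) (continuous_starAlgHom ψ)) h

end CStarSeminorm

/-! ### Canonical anticommutation relations in the C⋆-Clifford algebra -/

namespace SatisfiesCAR

variable {V : Type u} [NormedAddCommGroup V] [InnerProductSpace ℂ V]
  {B : Type w} [CStarAlgebra B] {b : V →ₗ⋆[ℂ] B}

/-- The real-linear map `v ↦ b(v) - b(v)*`. -/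
noncomputable def skewPart (b : V →ₗ⋆[ℂ] B) : V →ₗ[ℝ] B where
  toFun v := b v - star (b v)
  map_add' v w := by rw [map_add, star_add]; abel
  map_smul' r v := by
    rw [← Complex.coe_smul, b.map_smulₛₗ, Complex.conj_ofReal, Complex.coe_smul, star_smul,
      star_trivial, smul_sub, RingHom.id_apply]

theorem skewPart_mul_self (hb : SatisfiesCAR b) (v : V) :
    skewPart b v * skewPart b v = -((‖v‖ ^ 2 : ℝ) • (1 : B)) := by
  have h1 : b v * b v = 0 := by
    have h := hb.anticomm v v
    rw [← two_smul ℂ] at h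
    exact (smul_eq_zero.mp h).resolve_left two_ne_zero
  have h2 : star (b v) * star (b v) = 0 := by rw [← star_mul, h1, star_zero]
  have h3 := hb.star_anticomm v v
  rw [inner_self_eq_norm_sq_to_K] at h3
  change (b v - star (b v)) * (b v - star (b v)) = _
  rw [sub_mul, mul_sub, mul_sub, h1, h2, ← Complex.coe_smul]
  push_cast
  change _ = ((‖v‖ : ℂ) ^ 2) • (1 : B) at h3
  rw [← h3]
  abel

theorem star_skewPart (v : V) : star (skewPart b v) = -skewPart b v := by
  change star (b v - star (b v)) = -(b v - star (b v))
  rw [star_sub, star_star, neg_sub]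

/-- A map satisfying the canonical anticommutation relations extends to the algebraic Clifford
algebra. -/
noncomputable def liftClifford (hb : SatisfiesCAR b) : CliffordC V →⋆ₐ[ℂ] B :=
  CliffordC.lift (skewPart b) hb.skewPart_mul_self star_skewPart

end SatisfiesCAR

namespace CStarClifford

variable (V : Type u) [NormedAddCommGroup V] [InnerProductSpace ℂ V]

/-- The canonical ⋆-homomorphism from the algebraic Clifford algebra to the C⋆-Clifford algebra. -/
noncomputable def ofAlg : CliffordC V →⋆ₐ[ℂ] CStarClifford V :=
  (maxCStarSeminorm (CliffordC.bddAbove_repNorms V)).ofDomHom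

theorem ofAlg_ι (x : ℂ ⊗[ℝ] V) : ofAlg V (CliffordC.ι V x) = ι V x := rfl

theorem denseRange_ofAlg : DenseRange (ofAlg V) :=
  (maxCStarSeminorm (CliffordC.bddAbove_repNorms V)).denseRange_ofDom

theorem norm_ofAlg (x : CliffordC V) : ‖ofAlg V x‖ = maxCStarNorm x :=
  (maxCStarSeminorm (CliffordC.bddAbove_repNorms V)).norm_ofDom x

instance : Nontrivial (CStarClifford V) := by
  obtain ⟨B, _, _, ⟨f⟩⟩ := CliffordC.exists_nontrivial_starAlgHom V
  refine ⟨ofAlg V 1, 0, fun h => ?_⟩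
  have h1 := le_maxCStarNorm (CliffordC.bddAbove_repNorms V 1) (f : CliffordC V →⋆ₙₐ[ℂ] B)
  rw [← norm_ofAlg, h, norm_zero] at h1
  have h2 : f 1 = 0 := norm_le_zero_iff.mp h1
  rw [map_one] at h2
  exact one_ne_zero h2

theorem exists_extension {B : Type w} [CStarAlgebra B] (g : CliffordC V →⋆ₐ[ℂ] B) :
    ∃ φ : CStarClifford V →⋆ₐ[ℂ] B, ∀ a, φ (ofAlg V a) = g a :=
  CStarSeminorm.exists_extension (maxCStarSeminorm (CliffordC.bddAbove_repNorms V)) g fun a => by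
    rw [← CStarSeminorm.norm_ofDom]
    -- The bound comes from rigidity applied to `ofAlg V`, whose codomain is nonzero, and not from
    -- the supremum. Hence `B` may lie in any universe.
    exact CliffordC.norm_map_le g (ofAlg V) a

variable {V}

theorem star_ι (z : ℂ) (v : V) : star (ι V (z ⊗ₜ v)) = -ι V (conj z ⊗ₜ v) := by
  rw [← ofAlg_ι, ← map_star, CliffordC.star_ι, map_neg, ofAlg_ι]

theorem ι_one_tmul_mul_add_swap (v w : V) :
    ι V (1 ⊗ₜ v) * ι V (1 ⊗ₜ w) + ι V (1 ⊗ₜ w) * ι V (1 ⊗ₜ v) =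
      ((-2 * (inner ℂ v w).re : ℝ) : ℂ) • (1 : CStarClifford V) := by
  have h := congrArg (ofAlg V) (CliffordC.ι_one_tmul_mul_add_swap v w)
  simpa only [map_add, map_mul, map_smul, map_one, ofAlg_ι] using h

end CStarClifford

/-! ### CAR-representations: relations, generation, isometric extension and uniqueness -/

section Main

variable {V : Type u} [NormedAddCommGroup V] [InnerProductSpace ℂ V]

theorem carMap_apply (v : V) : carMap V v = (1 / 2 : ℂ) • (CStarClifford.ι V (1 ⊗ₜ v) +
    Complex.I • CStarClifford.ι V (1 ⊗ₜ (Complex.I • v))) := by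
  change CStarClifford.ι V _ = _
  rw [map_smul, map_add, map_smul]

theorem star_carMap (v : V) : star (carMap V v) = -((1 / 2 : ℂ) • (CStarClifford.ι V (1 ⊗ₜ v) -
    Complex.I • CStarClifford.ι V (1 ⊗ₜ (Complex.I • v)))) := by
  rw [carMap_apply, star_smul, star_add, star_smul, CStarClifford.star_ι, CStarClifford.star_ι]
  simp only [map_one, RCLike.star_def, Complex.conj_I, map_div₀, map_ofNat]
  module

/-- Recovers the Clifford generators from the CAR generators, so `carMap` generates the algebra and
determines every ⋆-homomorphism out of it. -/
theorem carMap_sub_star (v : V) :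
    carMap V v - star (carMap V v) = CStarClifford.ι V (1 ⊗ₜ v) := by
  rw [star_carMap, carMap_apply]
  module

theorem satisfiesCAR_carMap : SatisfiesCAR (carMap V) := by
  -- Both relations are instances. For `s = t = i` both `1 + s t` and `s - t` vanish; for `s = -i`,
  -- `t = i` they are `2` and `-2i`, which produces the conjugate of `inner ℂ v w`.
  have key : ∀ (s t : ℂ) (v w : V),
      (CStarClifford.ι V (1 ⊗ₜ v) + s • CStarClifford.ι V (1 ⊗ₜ (Complex.I • v))) *
        (CStarClifford.ι V (1 ⊗ₜ w) + t • CStarClifford.ι V (1 ⊗ₜ (Complex.I • w))) +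
      (CStarClifford.ι V (1 ⊗ₜ w) + t • CStarClifford.ι V (1 ⊗ₜ (Complex.I • w))) *
        (CStarClifford.ι V (1 ⊗ₜ v) + s • CStarClifford.ι V (1 ⊗ₜ (Complex.I • v))) =
      (-2 * ((1 + s * t) * (inner ℂ v w).re + (s - t) * (inner ℂ v w).im)) •
        (1 : CStarClifford V) := by
    intro s t v w
    have h1 := CStarClifford.ι_one_tmul_mul_add_swap v w
    have h2 := CStarClifford.ι_one_tmul_mul_add_swap (Complex.I • v) w
    have h3 := CStarClifford.ι_one_tmul_mul_add_swap v (Complex.I • w)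
    have h4 := CStarClifford.ι_one_tmul_mul_add_swap (Complex.I • v) (Complex.I • w)
    simp only [inner_smul_left, inner_smul_right, Complex.conj_I] at h2 h3 h4
    generalize CStarClifford.ι V (1 ⊗ₜ v) = a at *
    generalize CStarClifford.ι V (1 ⊗ₜ w) = b at *
    generalize CStarClifford.ι V (1 ⊗ₜ (Complex.I • v)) = a' at *
    generalize CStarClifford.ι V (1 ⊗ₜ (Complex.I • w)) = b' at *
    have e : (a + s • a') * (b + t • b') + (b + t • b') * (a + s • a') =
        (a * b + b * a) + s • (a' * b + b * a') + t • (a * b' + b' * a) +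
          (s * t) • (a' * b' + b' * a') := by
      simp only [add_mul, mul_add, smul_mul_assoc, mul_smul_comm, smul_add, smul_smul, mul_comm t s]
      abel
    rw [e, h1, h2, h3, h4]
    simp only [smul_smul, ← add_smul]
    congr 1
    simp
    ring
  refine ⟨fun v w => ?_, fun v w => ?_⟩
  · have h := key Complex.I Complex.I v w
    rw [carMap_apply, carMap_apply]
    simp only [smul_mul_smul_comm, ← smul_add, h, smul_smul]
    simp
  · have h := key (-Complex.I) Complex.I v w
    rw [star_carMap, carMap_apply, sub_eq_add_neg, ← neg_smul Complex.I, neg_mul, mul_neg, ← neg_add]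
    simp only [smul_mul_smul_comm, ← smul_add, h, smul_smul, ← neg_smul]
    congr 1
    have hre : (inner ℂ w v).re = (inner ℂ v w).re := by rw [← inner_conj_symm, Complex.conj_re]
    have him : (inner ℂ w v).im = -(inner ℂ v w).im := by rw [← inner_conj_symm, Complex.conj_im]
    apply Complex.ext <;> simp [hre, him] <;> ring

theorem ι_mem_adjoin_range_carMap (v : V) :
    CStarClifford.ι V (1 ⊗ₜ v) ∈ StarAlgebra.adjoin ℂ (Set.range (carMap V)) := by
  have h : carMap V v ∈ StarAlgebra.adjoin ℂ (Set.range (carMap V)) :=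
    StarAlgebra.subset_adjoin ℂ _ ⟨v, rfl⟩
  rw [← carMap_sub_star]
  exact sub_mem h (star_mem h)

theorem isCARRepresentation_carMap : IsCARRepresentation (carMap V) where
  toSatisfiesCAR := satisfiesCAR_carMap
  generates := by
    rw [eq_top_iff]
    intro x _
    change x ∈ closure _
    refine closure_mono ?_ (CStarClifford.denseRange_ofAlg V x)
    rintro _ ⟨a, rfl⟩
    rw [SetLike.mem_coe]
    induction a using CliffordC.induction with
    | h_smul z => rw [map_smul, map_one]; exact SMulMemClass.smul_mem z (one_mem _)
    | h_ι v => exact ι_mem_adjoin_range_carMap v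
    | h_mul a b ha hb => rw [map_mul]; exact mul_mem ha hb
    | h_add a b ha hb => rw [map_add]; exact add_mem ha hb

theorem starAlgHom_ext_carMap {B : Type w} [CStarAlgebra B] {φ ψ : CStarClifford V →⋆ₐ[ℂ] B}
    (h : ∀ v, φ (carMap V v) = ψ (carMap V v)) : φ = ψ := by
  refine CStarSeminorm.hom_ext _ fun a => ?_
  change φ (CStarClifford.ofAlg V a) = ψ (CStarClifford.ofAlg V a)
  induction a using CliffordC.induction with
  | h_smul z => simp only [map_smul, map_one]
  | h_ι v =>
    rw [CStarClifford.ofAlg_ι, ← carMap_sub_star, map_sub, map_sub, map_star, map_star, h]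
  | h_mul a b ha hb => simp only [map_mul, ha, hb]
  | h_add a b ha hb => simp only [map_add, ha, hb]

theorem SatisfiesCAR.exists_starAlgHom {B : Type w} [CStarAlgebra B] [Nontrivial B]
    {b : V →ₗ⋆[ℂ] B} (hb : SatisfiesCAR b) :
    ∃ φ : CStarClifford V →⋆ₐ[ℂ] B, (∀ v, φ (carMap V v) = b v) ∧ Isometry φ := by
  obtain ⟨φ, hφ⟩ := CStarClifford.exists_extension V hb.liftClifford
  refine ⟨φ, fun v => ?_, ?_⟩
  · have hι : ∀ w, φ (CStarClifford.ι V (1 ⊗ₜ w)) = b w - star (b w) := fun w => by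
      rw [← CStarClifford.ofAlg_ι, hφ, liftClifford, CliffordC.lift_ι, one_smul]; rfl
    -- Antilinearity gives `b(iv) = -i b(v)`, so `i (b(iv) - b(iv)*) = b(v) + b(v)*`. Half the sum
    -- with `b(v) - b(v)*` is `b(v)`.
    rw [carMap_apply]
    rw [map_smul, map_add, map_smul, hι, hι, b.map_smulₛₗ, Complex.conj_I, star_smul, smul_sub,
      smul_smul, smul_smul]
    simp only [star_neg, RCLike.star_def, Complex.conj_I, mul_neg, neg_neg, Complex.I_mul_I]
    module
  · refine AddMonoidHomClass.isometry_of_norm φ fun x => ?_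
    refine (CStarClifford.denseRange_ofAlg V).induction_on x
      (isClosed_eq (continuous_starAlgHom φ).norm continuous_norm) fun a => ?_
    rw [hφ]
    -- Rigidity in both directions: `B` and `CStarClifford V` are both nonzero.
    exact le_antisymm (CliffordC.norm_map_le _ _ a) (CliffordC.norm_map_le _ _ a)

/-- The range of an isometry from a complete space is closed. It contains `b(V)`, hence the closure
of the generated ⋆-algebra, which is everything. -/
theorem IsCARRepresentation.exists_starAlgEquiv {B : Type w} [CStarAlgebra B] [Nontrivial B]
    {b : V →ₗ⋆[ℂ] B} (hb : IsCARRepresentation b) :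
    ∃ φ : CStarClifford V ≃⋆ₐ[ℂ] B, ∀ v, φ (carMap V v) = b v := by
  obtain ⟨φ, hφ, hiso⟩ := hb.toSatisfiesCAR.exists_starAlgHom
  have hclosed : IsClosed (φ.range : Set B) := by
    change IsClosed (Set.range φ)
    exact hiso.isClosedEmbedding.isClosed_range
  have htop : (⊤ : StarSubalgebra ℂ B) ≤ φ.range := by
    rw [← hb.generates]
    refine StarSubalgebra.topologicalClosure_minimal (StarAlgebra.adjoin_le ?_) hclosed
    rintro _ ⟨v, rfl⟩
    exact ⟨carMap V v, hφ v⟩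
  exact ⟨StarAlgEquiv.ofBijective φ ⟨hiso.injective, fun x => htop (Set.mem_univ x)⟩, hφ⟩

end Main

theorem mainTheorem10 (V : Type u) [NormedAddCommGroup V] [InnerProductSpace ℂ V] :
    -- the C⋆-Clifford algebra with `a(v) = ½ (v + i J v)` is a CAR-representation
    (Nontrivial (CStarClifford V) ∧ IsCARRepresentation (carMap V)) ∧
    -- its universal property
    (∀ (B : Type w) [CStarAlgebra B] [Nontrivial B] (b : V →ₗ⋆[ℂ] B), SatisfiesCAR b →
      ∃ φ : CStarClifford V →⋆ₐ[ℂ] B, (∀ v, φ (carMap V v) = b v) ∧ Function.Injective φ ∧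
        ∀ ψ : CStarClifford V →⋆ₐ[ℂ] B, (∀ v, ψ (carMap V v) = b v) → ψ = φ) ∧
    -- existence of a CAR-representation
    (∃ (A : Type u) (_ : CStarAlgebra A) (_ : Nontrivial A) (a : V →ₗ⋆[ℂ] A),
      IsCARRepresentation a) ∧
    -- uniqueness of the CAR-representation up to isomorphism
    (∀ (A : Type w₁) [CStarAlgebra A] [Nontrivial A] (a : V →ₗ⋆[ℂ] A)
      (B : Type w₂) [CStarAlgebra B] [Nontrivial B] (b : V →ₗ⋆[ℂ] B),
      IsCARRepresentation a → IsCARRepresentation b →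
        ∃ Φ : A ≃⋆ₐ[ℂ] B, ∀ v, Φ (a v) = b v) := by
  refine ⟨⟨inferInstance, isCARRepresentation_carMap⟩, fun B _ _ b hb => ?_,
    ⟨_, inferInstance, inferInstance, _, isCARRepresentation_carMap⟩, fun A _ _ a B _ _ b ha hb => ?_⟩
  · obtain ⟨φ, hφ, hiso⟩ := hb.exists_starAlgHom
    exact ⟨φ, hφ, hiso.injective, fun ψ hψ => starAlgHom_ext_carMap fun v => by rw [hφ, hψ]⟩
  · obtain ⟨φ, hφ⟩ := ha.exists_starAlgEquiv
    obtain ⟨ψ, hψ⟩ := hb.exists_starAlgEquiv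
    refine ⟨φ.symm.trans ψ, fun v => ?_⟩
    rw [StarAlgEquiv.trans_apply, ← hφ, StarAlgEquiv.symm_apply_apply, hψ]
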